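/- All graphs are finite and simple. A vertex ordering of a graph $G$ is a total order $\preceq$ on $V(G)$. For a vertex $v$, a strong reachability path from $v$ is a path in $G$ that starts at $v$, ends in a vertex $u$ with $u\prec v$, and all of whose internal vertices are larger than $v$ in $\preceq$. For a positive integer $d$, let $\mathrm{adm}_d^{G,\preceq}(v)$ be the maximum size of a family of strong reachability paths from $v$, each with at most $d$ edges, that are pairwise vertex-disjoint apart from sharing $v$. The $d$-admissibility of $G$ is $$\mathrm{adm}_d(G)=\min_{\preceq}\ \max_{v\in V(G)}\ \mathrm{adm}_d^{G,\preceq}(v),$$ where the minimum is over all vertex orderings $\preceq$ of $G$. Proposition. For every integer $k\ge 2$ there is a planar graph $G$ with $\mathrm{adm}_{k2^{k+2}}(G)\ge 2^k-1$. Consequently, there is an absolute constant $c>0$ such that for every integer $d\ge 2$ there is a planar graph $G$ with $\mathrm{adm}_d(G)\ge c\,d/\ln d$; that is, the upper bound $\mathcal{O}(d/\ln d)$ on the $d$-admissibility of planar graphs is asymptotically tight. -/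

import Mathlib

/-- Planarity of a graph: it can be drawn in the plane with distinct vertices as distinct points
and every edge as an arc (an injective continuous image of `[0,1]`) joining its two ends, such that
the interior of an edge contains no vertex and no point of any other edge. -/
def IsPlanarGraph {V : Type*} (G : SimpleGraph V) : Prop :=
  ∃ (pos : V → ℝ × ℝ) (arc : G.edgeSet → unitInterval → ℝ × ℝ),
    Function.Injective pos ∧
    (∀ e, Continuous (arc e) ∧ Function.Injective (arc e)) ∧
    (∀ e, s(arc e 0, arc e 1) = Sym2.map pos (e : Sym2 V)) ∧
    (∀ e, ∀ t ∈ Set.Ioo (0 : unitInterval) 1, ∀ v, arc e t ≠ pos v) ∧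
    (∀ e f, e ≠ f → ∀ t ∈ Set.Ioo (0 : unitInterval) 1, ∀ s, arc e t ≠ arc f s)

/-- `P` is a (nontrivial) strong reachability path from `v` to `u` with respect to the vertex
ordering `o`: a path ending in a vertex `u` smaller than `v`, all of whose internal vertices are
larger than `v`. -/
def IsStrongReachPath {V : Type*} {G : SimpleGraph V} (o : LinearOrder V) {v u : V}
    (P : G.Walk v u) : Prop :=
  P.IsPath ∧ o.lt u v ∧ ∀ x ∈ P.support, x ≠ v → x ≠ u → o.lt v x

/-- `F` is a family of strong reachability paths of length at most `d` that start at `v` and are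
vertex-disjoint apart from sharing `v`. -/
def IsAdmFamily {V : Type*} (G : SimpleGraph V) (o : LinearOrder V) (d : ℕ) (v : V)
    (F : Finset (Σ u : V, G.Walk v u)) : Prop :=
  (∀ P ∈ F, IsStrongReachPath o P.2 ∧ P.2.length ≤ d) ∧
  ∀ P ∈ F, ∀ Q ∈ F, P ≠ Q → ∀ x, x ∈ P.2.support → x ∈ Q.2.support → x = v

/-- The `d`-admissibility of the vertex `v` in `G` with respect to the vertex ordering `o`
(for finite graphs the supremum is a maximum, see `admVertex_bddAbove`). -/
noncomputable def admVertex {V : Type*} (G : SimpleGraph V) (o : LinearOrder V) (d : ℕ) (v : V) :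
    ℕ :=
  sSup {n : ℕ | ∃ F : Finset (Σ u : V, G.Walk v u), IsAdmFamily G o d v F ∧ F.card = n}

/-- The `d`-admissibility of the vertex ordering `o` of `G`: the maximum over all vertices. -/
noncomputable def admOrder {V : Type*} (G : SimpleGraph V) (o : LinearOrder V) (d : ℕ) : ℕ :=
  ⨆ v : V, admVertex G o d v

/-- The `d`-admissibility of `G`: the minimum over all vertex orderings. -/
noncomputable def adm {V : Type*} (G : SimpleGraph V) (d : ℕ) : ℕ :=
  ⨅ o : LinearOrder V, admOrder G o d

theorem IsAdmFamily.card_le {V : Type*} [Fintype V] {G : SimpleGraph V} {o : LinearOrder V}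
    {d : ℕ} {v : V} {F : Finset (Σ u : V, G.Walk v u)} (h : IsAdmFamily G o d v F) :
    F.card ≤ Fintype.card V := by
  refine Finset.card_le_card_of_injOn (fun P => P.1) (fun _ _ => Finset.mem_univ _) ?_
  intro P hP Q hQ hPQ
  by_contra hne
  have hu : P.1 = v := h.2 P hP Q hQ hne P.1 P.2.end_mem_support
    (by rw [show P.1 = Q.1 from hPQ]; exact Q.2.end_mem_support)
  exact (ne_of_lt (h.1 P hP).1.2.1) hu

/-- In a finite graph the set defining `admVertex` is bounded. -/
theorem admVertex_bddAbove {V : Type*} [Fintype V] (G : SimpleGraph V) (o : LinearOrder V)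
    (d : ℕ) (v : V) :
    BddAbove {n : ℕ | ∃ F : Finset (Σ u : V, G.Walk v u), IsAdmFamily G o d v F ∧ F.card = n} :=
  ⟨Fintype.card V, by rintro n ⟨F, hF, rfl⟩; exact hF.card_le⟩

/-! In any ordering, let `leaf j` be the largest of D = 2^k marked leaves. Walks from it to all
other leaves that share only their start can be truncated to D - 1 disjoint strong reachability
paths. So it suffices that in one planar graph every leaf has short routes to all others, disjoint
apart from that leaf; routes from different starts may meet (`card_sub_one_le_adm`).

The graph is a binary tree whose nodes are bands of N = 2D - 1 wires. Where sibling bands join, the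
right one slides over the left one step by step, so left slot s meets right slot s' ≤ s at offset N
- (s - s'). A route climbs in a slot of `j` and, where that meets a slot of `i`, descends to `i`.
Targets right of `j` use the upper up slots and those left of it the lower ones; on each side up
slots decrease and down slots increase with the index of the target. Hence at a common height nearer
targets turn off earlier and the routes nest, which is what `TurnsAt.lane_up_ne_lane_down` and
`TurnsAt.lane_down_ne_lane_down` verify. -/

/-! ### Admissibility from disjoint routes -/

namespace SimpleGraph

variable {V : Type*} {G : SimpleGraph V}

/-- Truncating a walk from `v` to a smaller vertex yields a strong reachability path. -/
theorem Walk.exists_isStrongReachPath (o : LinearOrder V) {v u : V} (P : G.Walk v u)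
    (hu : o.lt u v) :
    ∃ (w : V) (Q : G.Walk v w), IsStrongReachPath o Q ∧ Q.length ≤ P.length ∧
      Q.support ⊆ P.support := by
  classical
  induction hn : P.length using Nat.strong_induction_on generalizing u with
  | _ n ih =>
    -- An offending internal vertex is itself smaller than `v`, hence a valid endpoint of a shorter
    -- walk.
    by_cases hx : ∃ x ∈ P.bypass.support, x ≠ v ∧ x ≠ u ∧ ¬ o.lt v x
    · obtain ⟨x, hxs, hxv, hxu, hlt⟩ := hx
      have hxP : x ∈ P.support := P.support_bypass_subset_support hxs
      have hlt' : o.lt x v := lt_of_le_of_ne (not_lt.mp hlt) hxv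
      have hlen := P.length_takeUntil_lt_length hxP hxu
      obtain ⟨w, Q, hQ, hl, hs⟩ := ih _ (hn ▸ hlen) (P.takeUntil x hxP) hlt' rfl
      exact ⟨w, Q, hQ, hl.trans (hn ▸ hlen.le), fun z hz =>
        P.support_takeUntil_subset_support hxP (hs hz)⟩
    · push Not at hx
      exact ⟨u, P.bypass, ⟨P.bypass_isPath, hu, hx⟩, hn ▸ P.length_bypass_le_length,
        P.support_bypass_subset_support⟩

/-- If the vertices `leaf i` are pairwise joined by walks of length at most `d` such that the walks
from each fixed one are disjoint apart from their start, then the `d`-admissibility is large. -/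
theorem card_sub_one_le_adm [Finite V] {ι : Type*} [Fintype ι] [Nonempty ι] {d : ℕ}
    (leaf : ι → V) (hleaf : Function.Injective leaf) (A : ι → ι → Set V)
    (hwalk : ∀ j i, j ≠ i → ∃ w : G.Walk (leaf j) (leaf i), w.length ≤ d ∧
      ∀ x ∈ w.support, x ∈ A j i)
    (hA : ∀ j i i', j ≠ i → j ≠ i' → i ≠ i' → ∀ x, x ∈ A j i → x ∈ A j i' → x = leaf j) :
    Fintype.card ι - 1 ≤ adm G d := by
  classical
  have := Fintype.ofFinite V
  have : Nonempty (LinearOrder V) :=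
    ⟨LinearOrder.lift' (Fintype.equivFin V) (Fintype.equivFin V).injective⟩
  refine le_ciInf fun o => ?_
  obtain ⟨j, hj⟩ := Finite.exists_max (β := V) leaf
  have key : ∀ i : {i // i ≠ j}, ∃ Q : Σ u : V, G.Walk (leaf j) u,
      (IsStrongReachPath o Q.2 ∧ Q.2.length ≤ d) ∧ ∀ x ∈ Q.2.support, x ∈ A j i := by
    rintro ⟨i, hi⟩
    obtain ⟨w, hw, hs⟩ := hwalk j i hi.symm
    obtain ⟨u, Q, hQ, hl, hsub⟩ := w.exists_isStrongReachPath o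
      (lt_of_le_of_ne (hj i) (hleaf.ne hi))
    exact ⟨⟨u, Q⟩, ⟨hQ, hl.trans hw⟩, fun x hx => hs x (hsub hx)⟩
  choose Q hQ hQA using key
  have hdisj : ∀ a b, a ≠ b → ∀ x, x ∈ (Q a).2.support → x ∈ (Q b).2.support → x = leaf j :=
    fun a b hab x ha hb => hA j a b a.2.symm b.2.symm (Subtype.coe_injective.ne hab) x
      (hQA a x ha) (hQA b x hb)
  have hinj : Function.Injective Q := by
    intro a b hab
    by_contra hne
    have := hdisj a b hne (Q a).1 (Q a).2.end_mem_support (hab ▸ (Q a).2.end_mem_support)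
    exact ne_of_lt (hQ a).1.2.1 this
  have hcard : (Finset.univ.image Q).card = Fintype.card ι - 1 := by
    rw [Finset.card_image_of_injective _ hinj, Finset.card_univ, Fintype.card_subtype_compl]
    simp
  have hv : Fintype.card ι - 1 ≤ admVertex G o d (leaf j) := by
    refine le_csSup (admVertex_bddAbove G o d _) ⟨Finset.univ.image Q, ⟨?_, ?_⟩, hcard⟩
    · simp only [Finset.mem_image, Finset.mem_univ, true_and]
      rintro _ ⟨a, rfl⟩
      exact hQ a
    · simp only [Finset.mem_image, Finset.mem_univ, true_and]
      rintro _ ⟨a, rfl⟩ _ ⟨b, rfl⟩ hab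
      exact hdisj a b fun h => hab (h ▸ rfl)
  exact hv.trans (le_ciSup (f := fun v => admVertex G o d v) (Set.finite_range _).bddAbove (leaf j))

end SimpleGraph

theorem IsPlanarGraph.induce {V : Type*} {G : SimpleGraph V} (h : IsPlanarGraph G) (s : Set V) :
    IsPlanarGraph (G.induce s) := by
  obtain ⟨pos, arc, h1, h2, h3, h4, h5⟩ := h
  have hmem : ∀ e : (G.induce s).edgeSet, Sym2.map Subtype.val (e : Sym2 s) ∈ G.edgeSet := by
    rintro ⟨e, he⟩
    induction e with
    | _ a b => simpa using he
  refine ⟨fun v => pos v, fun e => arc ⟨_, hmem e⟩, h1.comp Subtype.val_injective,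
    fun e => h2 _, fun e => ?_, fun e t ht v => h4 _ t ht v, fun e f hef => h5 _ _ fun h => hef ?_⟩
  · rw [h3]
    simp only [Sym2.map_map]
    rfl
  · exact Subtype.ext (Sym2.map.injective Subtype.val_injective (congrArg Subtype.val h))

/-- Only finitely many walks are used, so the construction may live on the infinite lattice and be
restricted to their vertices. -/
theorem IsPlanarGraph.exists_finite_card_sub_one_le_adm {V : Type} {G : SimpleGraph V}
    (hG : IsPlanarGraph G) {ι : Type*} [Fintype ι] [Nonempty ι] {d : ℕ}
    (leaf : ι → V) (hleaf : Function.Injective leaf) (A : ι → ι → Set V)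
    (hwalk : ∀ j i, j ≠ i → ∃ w : G.Walk (leaf j) (leaf i), w.length ≤ d ∧
      ∀ x ∈ w.support, x ∈ A j i)
    (hA : ∀ j i i', j ≠ i → j ≠ i' → i ≠ i' → ∀ x, x ∈ A j i → x ∈ A j i' → x = leaf j) :
    ∃ (W : Type) (_ : Fintype W) (H : SimpleGraph W),
      IsPlanarGraph H ∧ Fintype.card ι - 1 ≤ adm H d := by
  choose w hw hs using hwalk
  let T : Set V := Set.range leaf ∪ ⋃ j, ⋃ i, ⋃ h : j ≠ i, {x | x ∈ (w j i h).support}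
  have hT : T.Finite := (Set.finite_range leaf).union <| Set.finite_iUnion fun j =>
    Set.finite_iUnion fun i => Set.finite_iUnion fun h => List.finite_toSet _
  have hsub : ∀ j i h, ∀ x ∈ (w j i h).support, x ∈ T := fun j i h x hx =>
    Or.inr (Set.mem_iUnion.2 ⟨j, Set.mem_iUnion.2 ⟨i, Set.mem_iUnion.2 ⟨h, hx⟩⟩⟩)
  have : Finite T := hT
  refine ⟨T, Fintype.ofFinite T, G.induce T, hG.induce T, ?_⟩
  refine SimpleGraph.card_sub_one_le_adm (fun i => ⟨leaf i, Or.inl ⟨i, rfl⟩⟩)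
    (fun a b h => hleaf (congrArg Subtype.val h)) (fun j i => Subtype.val ⁻¹' A j i) ?_ ?_
  · intro j i h
    refine ⟨(w j i h).induce T (hsub j i h), ?_, ?_⟩
    · have h1 := congrArg List.length ((w j i h).support_induce (hsub j i h))
      rw [List.length_attachWith, SimpleGraph.Walk.length_support,
        SimpleGraph.Walk.length_support] at h1
      exact (Nat.succ.inj h1).trans_le (hw j i h)
    · intro x hx
      simp only [SimpleGraph.Walk.support_induce, List.mem_attachWith] at hx
      exact hs j i h x hx
  · exact fun j i i' h h' hi x hx hx' => Subtype.ext (hA j i i' h h' hi x hx hx')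

/-! ### Planar drawings of level graphs -/

/-- The graph on the lattice points `(y, x)` in which the points `(y, a)` and `(y + 1, b)` of
consecutive levels are adjacent whenever `E y a b`. -/
def levelGraph (E : ℕ → ℕ → ℕ → Prop) : SimpleGraph (ℕ × ℕ) where
  Adj p q := (q.1 = p.1 + 1 ∧ E p.1 p.2 q.2) ∨ (p.1 = q.1 + 1 ∧ E q.1 q.2 p.2)
  symm := ⟨fun _ _ h => h.symm⟩
  loopless := ⟨fun p h => by omega⟩

/-- Draw edges as straight segments. Segments from different strips can meet only at a level; within
a strip, monotonicity of `E` keeps distinct lower ends strictly ordered until the top, where edges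
may merge. -/
theorem isPlanarGraph_levelGraph {E : ℕ → ℕ → ℕ → Prop}
    (hE : ∀ y a a' b b', E y a a' → E y b b' → a < b → a' ≤ b') :
    IsPlanarGraph (levelGraph E) := by
  have key : ∀ e : (levelGraph E).edgeSet, ∃ y a b : ℕ, E y a b ∧
      (e : Sym2 (ℕ × ℕ)) = s((y, a), (y + 1, b)) := by
    rintro ⟨e, he⟩
    induction e with
    | _ p q =>
      obtain ⟨y, a⟩ := p
      obtain ⟨z, b⟩ := q
      rcases he with ⟨h, h'⟩ | ⟨h, h'⟩ <;> dsimp only at h h' <;> subst h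
      · exact ⟨y, a, b, h', rfl⟩
      · exact ⟨z, b, a, h', Sym2.eq_swap⟩
  choose y a b hab he using key
  refine ⟨fun p => (p.2, p.1),
    fun e t => (a e + t * ((b e : ℝ) - a e), y e + t), ?_, ?_, ?_, ?_, ?_⟩
  · rintro ⟨p, q⟩ ⟨p', q'⟩ h
    simp only [Prod.mk.injEq, Nat.cast_inj] at h
    exact Prod.ext h.2 h.1
  · refine fun e => ⟨by fun_prop, fun s t h => ?_⟩
    simp only [Prod.mk.injEq, add_right_inj] at h
    exact Subtype.ext h.2
  · intro e
    rw [he e]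
    simp
  · rintro e t ⟨h0, h1⟩ v h
    have h0 : (0 : ℝ) < t := h0
    have h1 : (t : ℝ) < 1 := h1
    have h2 : (y e : ℝ) + t = v.1 := (Prod.ext_iff.1 h).2
    have h3 : y e < v.1 := by exact_mod_cast (by linarith : (y e : ℝ) < v.1)
    have h4 : v.1 < y e + 1 := by exact_mod_cast (by linarith : (v.1 : ℝ) < y e + 1)
    omega
  · rintro e f hef t ⟨h0, h1⟩ s h
    have h0 : (0 : ℝ) < t := h0
    have h1 : (t : ℝ) < 1 := h1
    have s0 : (0 : ℝ) ≤ s := s.2.1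
    have s1 : (s : ℝ) ≤ 1 := s.2.2
    obtain ⟨hx, hy⟩ := Prod.ext_iff.1 h
    dsimp only at hx hy
    have h3 : y e < y f + 1 := by exact_mod_cast (by linarith : (y e : ℝ) < y f + 1)
    have h4 : y f < y e + 1 := by exact_mod_cast (by linarith : (y f : ℝ) < y e + 1)
    have hyy : y e = y f := by omega
    have hst : (s : ℝ) = t := by rw [hyy] at hy; linarith
    rw [hst] at hx
    have hEf := hab f
    rw [← hyy] at hEf
    rcases lt_trichotomy (a e) (a f) with hlt | heq | hlt
    · have h5 : (b e : ℝ) ≤ b f := by exact_mod_cast hE _ _ _ _ _ (hab e) hEf hlt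
      have h6 : (a e : ℝ) < a f := by exact_mod_cast hlt
      nlinarith
    · have h5 : (b e : ℝ) = b f := by
        rw [heq] at hx
        have : (t : ℝ) * (b e - b f) = 0 := by linarith
        rcases mul_eq_zero.1 this with h | h <;> linarith
      refine hef (Subtype.ext ?_)
      rw [he e, he f, hyy, heq, Nat.cast_inj.1 h5]
    · have h5 : (b f : ℝ) ≤ b e := by exact_mod_cast hE _ _ _ _ _ hEf (hab e) hlt
      have h6 : (a f : ℝ) < a e := by exact_mod_cast hlt
      nlinarith

/-- A sequence of successively adjacent vertices gives a walk. -/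
theorem SimpleGraph.exists_walk_of_forall_adj {V : Type*} {G : SimpleGraph V} (f : ℕ → V)
    (n : ℕ) (hf : ∀ m, m < n → G.Adj (f m) (f (m + 1))) :
    ∃ w : G.Walk (f 0) (f n), w.length = n ∧ ∀ x ∈ w.support, ∃ m ≤ n, x = f m := by
  induction n with
  | zero => exact ⟨.nil, rfl, by simp⟩
  | succ n ih =>
    obtain ⟨w, hl, hs⟩ := ih fun m hm => hf m (hm.trans n.lt_succ_self)
    refine ⟨w.concat (hf n n.lt_succ_self), by simp [hl], fun x hx => ?_⟩
    rw [Walk.support_concat, List.mem_append, List.mem_singleton] at hx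
    rcases hx with hx | rfl
    · obtain ⟨m, hm, rfl⟩ := hs x hx
      exact ⟨m, hm.trans n.le_succ, rfl⟩
    · exact ⟨n + 1, le_rfl, rfl⟩

/-! ### The thickened binary tree and its wires -/

/-- The edges between the levels `y` and `y + 1` of a drawing of a thickened binary tree. Its leaves
lie on level `0` and see `N` wires each. Between the levels `g * (N + 1) + 1` and `(g + 1) * (N + 1)`
the wires of a right child may be shifted over those of its left sibling, and above every level
divisible by `N + 1` the blocks of `N` wires of two siblings are put side by side. -/
def TreeEdge (N y a b : ℕ) : Prop :=
  (y = 0 ∧ b / N = a) ∨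
  (y ≠ 0 ∧ N + 1 ∣ y ∧ ∃ c q, q < N ∧ a = 2 * N * c + q ∧ b = N * c + q) ∨
  (¬ N + 1 ∣ y ∧ (b = a ∨ b + 1 = a))

theorem TreeEdge.le_of_lt {N y a a' b b' : ℕ} (h : TreeEdge N y a a') (h' : TreeEdge N y b b')
    (hab : a < b) : a' ≤ b' := by
  rcases h with ⟨h0, h1⟩ | ⟨h0, hd, c, q, hq, rfl, rfl⟩ | ⟨hd, h1⟩ <;>
  rcases h' with ⟨h0', h1'⟩ | ⟨h0', hd', c', q', hq', rfl, rfl⟩ | ⟨hd', h1'⟩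
  any_goals omega
  · by_contra hlt
    have := Nat.div_le_div_right (c := N) (not_le.1 hlt).le
    omega
  · exact absurd (h0 ▸ dvd_zero _) hd'
  · have hc : c ≤ c' := by
      by_contra hlt
      have := Nat.mul_le_mul_left (2 * N) (not_le.1 hlt)
      rw [Nat.mul_succ] at this
      omega
    rcases hc.eq_or_lt with rfl | hc
    · omega
    · have := Nat.mul_le_mul_left N hc
      rw [Nat.mul_succ] at this
      omega
  · exact absurd (h0' ▸ dvd_zero _) hd

/-- The position of the wire with slot `s` of the leaf `j` at height `g` and offset `l`. -/
def lane (N j s g l : ℕ) : ℕ :=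
  2 * N * (j / 2 ^ (g + 1)) + (s + j / 2 ^ g % 2 * (N - l))

/-- The position on level `y` of the wire with slot `s` of the leaf `j`. -/
def wire (N j s y : ℕ) : ℕ :=
  if y = 0 then j else lane N j s ((y - 1) / (N + 1)) ((y - 1) % (N + 1))

theorem wire_zero (N j s : ℕ) : wire N j s 0 = j := rfl

theorem wire_eq_lane {N l : ℕ} (hl : l ≤ N) (j s g : ℕ) :
    wire N j s (g * (N + 1) + l + 1) = lane N j s g l := by
  have h1 : (g * (N + 1) + l) / (N + 1) = g := by
    rw [Nat.add_comm, Nat.add_mul_div_right _ _ N.succ_pos, Nat.div_eq_of_lt (by omega), zero_add]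
  have h2 : (g * (N + 1) + l) % (N + 1) = l := by
    rw [Nat.add_comm, Nat.add_mul_mod_self_right, Nat.mod_eq_of_lt (by omega)]
  rw [wire, if_neg (by omega), Nat.add_sub_cancel, h1, h2]

theorem exists_level_eq (N : ℕ) {y : ℕ} (hy : y ≠ 0) :
    ∃ g l, l ≤ N ∧ y = g * (N + 1) + l + 1 := by
  refine ⟨(y - 1) / (N + 1), (y - 1) % (N + 1), Nat.lt_succ_iff.1 (Nat.mod_lt _ N.succ_pos), ?_⟩
  rw [Nat.div_add_mod']
  omega

theorem Nat.div_two_pow_succ (j g : ℕ) : j / 2 ^ (g + 1) = j / 2 ^ g / 2 := by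
  rw [pow_succ, Nat.div_div_eq_div_mul]

theorem Nat.div_two_pow_eq_of_le {i j g h : ℕ} (hgh : g ≤ h) (hij : i / 2 ^ g = j / 2 ^ g) :
    i / 2 ^ h = j / 2 ^ h := by
  obtain ⟨c, rfl⟩ := Nat.exists_eq_add_of_le hgh
  rw [pow_add, ← Nat.div_div_eq_div_mul, ← Nat.div_div_eq_div_mul, hij]

theorem lane_zero_right (N j s g : ℕ) : lane N j s g 0 = N * (j / 2 ^ g) + s := by
  rw [lane, Nat.div_two_pow_succ]
  conv_rhs => rw [← Nat.div_add_mod (j / 2 ^ g) 2]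
  rw [Nat.sub_zero]
  ring

theorem treeEdge_wire {N s : ℕ} (hs : s < N) (j y : ℕ) :
    TreeEdge N y (wire N j s y) (wire N j s (y + 1)) := by
  rcases eq_or_ne y 0 with rfl | hy
  · refine Or.inl ⟨rfl, ?_⟩
    have := wire_eq_lane (Nat.zero_le N) j s 0
    rw [zero_mul, zero_add] at this
    rw [this, lane_zero_right, pow_zero, Nat.div_one, wire_zero,
      Nat.mul_add_div (by omega), Nat.div_eq_of_lt hs, add_zero]
  · obtain ⟨g, l, hl, rfl⟩ := exists_level_eq N hy
    rcases hl.eq_or_lt with rfl | hlt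
    · have h1 : g * (l + 1) + l + 1 = (g + 1) * (l + 1) + 0 := by ring
      refine Or.inr (Or.inl ⟨hy, ⟨g + 1, by rw [h1]; ring⟩, j / 2 ^ (g + 1), s, hs, ?_, ?_⟩)
      · rw [wire_eq_lane le_rfl, lane, Nat.sub_self, mul_zero, add_zero]
      · rw [h1, wire_eq_lane (Nat.zero_le _), lane_zero_right]
    · refine Or.inr (Or.inr ⟨?_, ?_⟩)
      · rw [add_assoc, Nat.dvd_add_right (Dvd.intro_left g rfl)]
        exact fun h => absurd (Nat.le_of_dvd (Nat.succ_pos l) h) (by omega)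
      · rw [wire_eq_lane hl, add_assoc _ l 1, wire_eq_lane hlt, lane, lane]
        rcases Nat.mod_two_eq_zero_or_one (j / 2 ^ g) with h | h <;> rw [h] <;> omega

/-- The second summand of a lane is below 2N, so the two conclusions are quotient and remainder
modulo 2N. -/
theorem lane_inj {N i j s s' g l : ℕ} (hs : s < N) (hs' : s' < N)
    (h : lane N j s g l = lane N i s' g l) :
    j / 2 ^ (g + 1) = i / 2 ^ (g + 1) ∧
      s + j / 2 ^ g % 2 * (N - l) = s' + i / 2 ^ g % 2 * (N - l) := by
  have hlt : ∀ t < N, ∀ m : ℕ, t + m % 2 * (N - l) < 2 * N := by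
    intro t ht m
    rcases Nat.mod_two_eq_zero_or_one m with h | h <;> rw [h] <;> omega
  have h1 := congrArg (· / (2 * N)) h
  have h2 := congrArg (· % (2 * N)) h
  simp only [lane, Nat.mul_add_mod, Nat.mul_add_div (show 0 < 2 * N by omega),
    Nat.mod_eq_of_lt (hlt _ hs _), Nat.mod_eq_of_lt (hlt _ hs' _),
    Nat.div_eq_of_lt (hlt _ hs _), Nat.div_eq_of_lt (hlt _ hs' _), add_zero] at h1 h2
  exact ⟨h1, h2⟩

/-! ### Routing between leaves -/

/-- The slot in which the route from leaf `j` to leaf `i` goes up. -/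
def upSlot (D j i : ℕ) : ℕ := if j < i then 2 * D - 2 - i else D - 2 - i

/-- The slot in which the route from leaf `j` to leaf `i` goes down. -/
def downSlot (D j i : ℕ) : ℕ := if j < i then i else i + D - 1

/-- The route from leaf `j` to leaf `i` turns at height `g` and offset `l`. -/
structure TurnsAt (D j i g l : ℕ) : Prop where
  offset_le : l ≤ 2 * D - 1
  div_succ_eq : j / 2 ^ (g + 1) = i / 2 ^ (g + 1)
  div_ne : j / 2 ^ g ≠ i / 2 ^ g
  slot_eq : upSlot D j i + j / 2 ^ g % 2 * (2 * D - 1 - l) =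
    downSlot D j i + i / 2 ^ g % 2 * (2 * D - 1 - l)

theorem upSlot_lt {D j i : ℕ} (hi : i < D) : upSlot D j i < 2 * D - 1 := by
  unfold upSlot; split <;> omega

theorem downSlot_lt {D j i : ℕ} (hi : i < D) : downSlot D j i < 2 * D - 1 := by
  unfold downSlot; split <;> omega

theorem exists_turnsAt {k j i : ℕ} (hj : j < 2 ^ k) (hi : i < 2 ^ k) (hij : j ≠ i) :
    ∃ g l, g < k ∧ TurnsAt (2 ^ k) j i g l := by
  -- The turn happens just below the lowest common ancestor; the offset is then forced by `slot_eq`.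
  have hex : ∃ m, j / 2 ^ m = i / 2 ^ m :=
    ⟨k, by rw [Nat.div_eq_of_lt hj, Nat.div_eq_of_lt hi]⟩
  obtain ⟨g, hg⟩ : ∃ g, Nat.find hex = g + 1 := Nat.exists_eq_succ_of_ne_zero fun h => hij <| by
    simpa [h] using Nat.find_spec hex
  have h1 : j / 2 ^ (g + 1) = i / 2 ^ (g + 1) := hg ▸ Nat.find_spec hex
  have h2 : j / 2 ^ g ≠ i / 2 ^ g := Nat.find_min hex (by omega)
  have h3 : g < k := by
    have := Nat.find_min' hex (show j / 2 ^ k = i / 2 ^ k by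
      rw [Nat.div_eq_of_lt hj, Nat.div_eq_of_lt hi])
    omega
  have h4 := h1
  rw [Nat.div_two_pow_succ, Nat.div_two_pow_succ] at h4
  generalize 2 ^ k = D at *
  rcases lt_or_gt_of_ne hij with h | h
  · have := Nat.div_le_div_right (c := 2 ^ g) h.le
    have e1 : j / 2 ^ g % 2 = 0 := by omega
    have e2 : i / 2 ^ g % 2 = 1 := by omega
    refine ⟨g, 2 * D - 1 - (2 * D - 2 - i - i), h3, by omega, h1, h2, ?_⟩
    rw [e1, e2, upSlot, downSlot, if_pos h, if_pos h]
    omega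
  · have := Nat.div_le_div_right (c := 2 ^ g) h.le
    have e1 : j / 2 ^ g % 2 = 1 := by omega
    have e2 : i / 2 ^ g % 2 = 0 := by omega
    refine ⟨g, 2 * D - 1 - (i + D - 1 - (D - 2 - i)), h3, by omega, h1, h2, ?_⟩
    rw [e1, e2, upSlot, downSlot, if_neg h.not_gt, if_neg h.not_gt]
    omega

/-- Ancestors that agree once agree at all greater heights. -/
theorem TurnsAt.height_eq {D j i g g' l : ℕ} (h : TurnsAt D j i g l) (hg : g' ≤ g)
    (hij : j / 2 ^ (g' + 1) = i / 2 ^ (g' + 1)) : g' = g := by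
  by_contra hne
  exact h.div_ne (Nat.div_two_pow_eq_of_le (by omega) hij)

theorem upSlot_injOn {D j i i' : ℕ} (hj : j < D) (hi : i < D) (hi' : i' < D) (hji : j ≠ i)
    (hji' : j ≠ i') (h : upSlot D j i = upSlot D j i') : i = i' := by
  unfold upSlot at h
  split at h <;> split at h <;> omega

theorem between_of_upSlot_lt {D j i i' : ℕ} (hi' : i' < D) (hlt : j < i')
    (h : upSlot D j i' < upSlot D j i) : j < i ∧ i < i' := by
  unfold upSlot at h
  split at h <;> split at h <;> omega

theorem between_of_upSlot_gt {D j i i' : ℕ} (hj : j < D) (hi : i < D) (hji : j ≠ i) (hlt : i' < j)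
    (h : upSlot D j i < upSlot D j i') : i' < i ∧ i < j := by
  unfold upSlot at h
  split at h <;> split at h <;> omega

/-- The upward part of a route avoids the downward parts of the others. -/
theorem TurnsAt.lane_up_ne_lane_down {D j i i' g₁ l₁ g₂ l₂ g l : ℕ} (h₁ : TurnsAt D j i g₁ l₁)
    (h₂ : TurnsAt D j i' g₂ l₂) (hj : j < D) (hi : i < D) (hi' : i' < D) (hii : i ≠ i')
    (hg₁ : g < g₁ ∨ g = g₁ ∧ l ≤ l₁) (hg₂ : g < g₂ ∨ g = g₂ ∧ l ≤ l₂) :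
    lane (2 * D - 1) j (upSlot D j i) g l ≠ lane (2 * D - 1) i' (downSlot D j i') g l := by
  intro h
  obtain ⟨hb, hs⟩ := lane_inj (upSlot_lt hi) (downSlot_lt hi') h
  obtain rfl := h₂.height_eq (by omega) hb
  have hl₂ : l ≤ l₂ := by omega
  have hji : j ≠ i := by rintro rfl; exact h₁.div_ne rfl
  have hji' : j ≠ i' := by rintro rfl; exact h₂.div_ne rfl
  have hne : upSlot D j i ≠ upSlot D j i' := fun h => hii (upSlot_injOn hj hi hi' hji hji' h)
  have hb₂ := h₂.slot_eq
  have hd₂ := h₂.div_ne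
  have hd₁ := h₁.div_ne
  have ho₁ := h₁.slot_eq
  have hb' := hb
  rw [Nat.div_two_pow_succ, Nat.div_two_pow_succ] at hb'
  -- A leaf between two leaves with a common ancestor has that ancestor too.
  have hbetween : (j < i ∧ i < i') ∨ (i' < i ∧ i < j) → g = g₁ ∧ l ≤ l₁ ∧
      j / 2 ^ g / 2 = i / 2 ^ g / 2 := by
    intro hc
    have hq : j / 2 ^ g / 2 = i / 2 ^ g / 2 := by
      rcases hc with ⟨hc, hc'⟩ | ⟨hc, hc'⟩ <;>
      · have e1 := Nat.div_le_div_right (c := 2 ^ g) hc.le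
        have e2 := Nat.div_le_div_right (c := 2 ^ g) hc'.le
        omega
    have := h₁.height_eq (g' := g) (by omega) (by
      rw [Nat.div_two_pow_succ, Nat.div_two_pow_succ, hq])
    exact ⟨this, by omega, hq⟩
  rcases lt_or_gt_of_ne hji' with hlt | hlt
  · have := Nat.div_le_div_right (c := 2 ^ g) hlt.le
    have e1 : j / 2 ^ g % 2 = 0 := by omega
    have e2 : i' / 2 ^ g % 2 = 1 := by omega
    rw [e1, e2] at hs hb₂
    have hc : j < i ∧ i < i' := between_of_upSlot_lt hi' hlt (by omega)
    obtain ⟨rfl, hll, hq⟩ := hbetween (Or.inl hc)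
    have e3 : i / 2 ^ g % 2 = 1 := by omega
    rw [e1, e3] at ho₁
    -- As `l ≤ l₁`, the two slot equations give `downSlot D j i' ≤ downSlot D j i`, that is i' ≤ i.
    unfold downSlot at hs ho₁
    rw [if_pos hlt] at hs
    rw [if_pos hc.1] at ho₁
    omega
  · have := Nat.div_le_div_right (c := 2 ^ g) hlt.le
    have e1 : j / 2 ^ g % 2 = 1 := by omega
    have e2 : i' / 2 ^ g % 2 = 0 := by omega
    rw [e1, e2] at hs hb₂
    have hc : i' < i ∧ i < j := between_of_upSlot_gt hj hi hji hlt (by omega)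
    obtain ⟨rfl, hll, hq⟩ := hbetween (Or.inr hc)
    have e3 : i / 2 ^ g % 2 = 0 := by omega
    rw [e1, e3] at ho₁
    unfold downSlot at hs ho₁
    rw [if_neg hlt.not_gt] at hs
    rw [if_neg hc.2.not_gt] at ho₁
    omega

/-- The downward parts of the routes from a fixed leaf are disjoint. -/
theorem TurnsAt.lane_down_ne_lane_down {D j i i' g₁ l₁ g₂ l₂ g l : ℕ} (h₁ : TurnsAt D j i g₁ l₁)
    (h₂ : TurnsAt D j i' g₂ l₂) (hi : i < D) (hi' : i' < D) (hii : i ≠ i')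
    (hg₁ : g ≤ g₁) (hg₂ : g ≤ g₂) :
    lane (2 * D - 1) i (downSlot D j i) g l ≠ lane (2 * D - 1) i' (downSlot D j i') g l := by
  intro h
  wlog hlt : i < i' generalizing i i' g₁ l₁ g₂ l₂
  · exact this h₂ h₁ hi' hi hii.symm hg₂ hg₁ h.symm (by omega)
  obtain ⟨hb, hs⟩ := lane_inj (downSlot_lt hi) (downSlot_lt hi') h
  have hji : j ≠ i := by rintro rfl; exact h₁.div_ne rfl
  have hji' : j ≠ i' := by rintro rfl; exact h₂.div_ne rfl
  have hb' := hb
  rw [Nat.div_two_pow_succ, Nat.div_two_pow_succ] at hb'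
  have hle := Nat.div_le_div_right (c := 2 ^ g) hlt.le
  -- If `j` lay between `i` and `i'`, both routes would turn at `g`, putting `i` and `i'` in the
  -- same child, which would then contain `j` as well.
  have hside : j < i ∨ i' < j := by
    by_contra hc
    have e1 := Nat.div_le_div_right (c := 2 ^ g) (show i ≤ j by omega)
    have e2 := Nat.div_le_div_right (c := 2 ^ g) (show j ≤ i' by omega)
    obtain rfl := h₁.height_eq hg₁ (by rw [Nat.div_two_pow_succ, Nat.div_two_pow_succ]; omega)
    obtain rfl := h₂.height_eq hg₂ (by rw [Nat.div_two_pow_succ, Nat.div_two_pow_succ]; omega)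
    have := h₁.div_ne
    have := h₂.div_ne
    omega
  have hslot : downSlot D j i < downSlot D j i' := by
    unfold downSlot
    rcases hside with h | h
    · rw [if_pos h, if_pos (by omega)]; exact hlt
    · rw [if_neg (by omega), if_neg (by omega)]; omega
  rcases Nat.mod_two_eq_zero_or_one (i / 2 ^ g) with e1 | e1 <;>
  rcases Nat.mod_two_eq_zero_or_one (i' / 2 ^ g) with e2 | e2 <;>
  rw [e1, e2] at hs <;> omega

/-- The vertices of the route from leaf `j` to leaf `i` that turns on level `Y`. -/
def routeSet (D Y j i : ℕ) : Set (ℕ × ℕ) :=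
  {x | x.1 ≤ Y ∧ (x.2 = wire (2 * D - 1) j (upSlot D j i) x.1 ∨
    x.2 = wire (2 * D - 1) i (downSlot D j i) x.1)}

theorem TurnsAt.routeSet_inter {D j i i' g₁ l₁ g₂ l₂ : ℕ} (h₁ : TurnsAt D j i g₁ l₁)
    (h₂ : TurnsAt D j i' g₂ l₂) (hj : j < D) (hi : i < D) (hi' : i' < D) (hii : i ≠ i')
    {x : ℕ × ℕ} (hx₁ : x ∈ routeSet D (g₁ * (2 * D - 1 + 1) + l₁ + 1) j i)
    (hx₂ : x ∈ routeSet D (g₂ * (2 * D - 1 + 1) + l₂ + 1) j i') : x = (0, j) := by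
  have hji : j ≠ i := by rintro rfl; exact h₁.div_ne rfl
  have hji' : j ≠ i' := by rintro rfl; exact h₂.div_ne rfl
  obtain ⟨y, x⟩ := x
  obtain ⟨hy₁, hx₁⟩ := hx₁
  obtain ⟨hy₂, hx₂⟩ := hx₂
  dsimp only at hy₁ hy₂ hx₁ hx₂
  rcases eq_or_ne y 0 with rfl | hy
  · simp only [wire_zero] at hx₁ hx₂
    rw [show x = j by omega]
  exfalso
  obtain ⟨g, l, hl, rfl⟩ := exists_level_eq (2 * D - 1) hy
  -- Levels compare lexicographically by height and offset.
  have hcmp : ∀ g' l', g * (2 * D - 1 + 1) + l + 1 ≤ g' * (2 * D - 1 + 1) + l' + 1 →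
      l' ≤ 2 * D - 1 → g < g' ∨ g = g' ∧ l ≤ l' := by
    intro g' l' h hl'
    rcases lt_trichotomy g g' with h' | rfl | h'
    · exact Or.inl h'
    · exact Or.inr ⟨rfl, by omega⟩
    · have := Nat.mul_le_mul_right (2 * D - 1 + 1) h'
      rw [Nat.succ_mul] at this
      omega
  have hc₁ := hcmp _ _ hy₁ h₁.offset_le
  have hc₂ := hcmp _ _ hy₂ h₂.offset_le
  simp only [wire_eq_lane hl] at hx₁ hx₂
  rcases hx₁ with hx₁ | hx₁ <;> rcases hx₂ with hx₂ | hx₂ <;> rw [hx₁] at hx₂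
  · have := (lane_inj (upSlot_lt hi) (upSlot_lt hi') hx₂).2
    exact hii (upSlot_injOn hj hi hi' hji hji' (Nat.add_right_cancel this))
  · exact h₁.lane_up_ne_lane_down h₂ hj hi hi' hii hc₁ hc₂ hx₂
  · exact h₂.lane_up_ne_lane_down h₁ hj hi' hi hii.symm hc₂ hc₁ hx₂.symm
  · exact h₁.lane_down_ne_lane_down h₂ hi hi' hii (by omega) (by omega) hx₂

theorem TurnsAt.exists_walk {D j i g l : ℕ} (h : TurnsAt D j i g l) (hi : i < D) :
    ∃ w : (levelGraph (TreeEdge (2 * D - 1))).Walk (0, j) (0, i),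
      w.length = 2 * (g * (2 * D - 1 + 1) + l + 1) ∧
      ∀ x ∈ w.support, x ∈ routeSet D (g * (2 * D - 1 + 1) + l + 1) j i := by
  set Y := g * (2 * D - 1 + 1) + l + 1 with hY
  have hadj : ∀ a s, s < 2 * D - 1 → ∀ m, m < Y → (levelGraph (TreeEdge (2 * D - 1))).Adj
      (m, wire (2 * D - 1) a s m) (m + 1, wire (2 * D - 1) a s (m + 1)) :=
    fun a s hs m _ => Or.inl ⟨rfl, treeEdge_wire hs a m⟩
  obtain ⟨w₁, hl₁, hs₁⟩ := SimpleGraph.exists_walk_of_forall_adj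
    (fun m => (m, wire (2 * D - 1) j (upSlot D j i) m)) Y (hadj _ _ (upSlot_lt hi))
  obtain ⟨w₂, hl₂, hs₂⟩ := SimpleGraph.exists_walk_of_forall_adj
    (fun m => (m, wire (2 * D - 1) i (downSlot D j i) m)) Y (hadj _ _ (downSlot_lt hi))
  have hend : wire (2 * D - 1) i (downSlot D j i) Y = wire (2 * D - 1) j (upSlot D j i) Y := by
    rw [hY, wire_eq_lane h.offset_le, wire_eq_lane h.offset_le, lane, lane, h.div_succ_eq,
      h.slot_eq]
  refine ⟨(w₁.copy (by rw [wire_zero]) rfl).append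
    (w₂.copy (by rw [wire_zero]) (by rw [hend])).reverse, ?_, fun x hx => ?_⟩
  · rw [SimpleGraph.Walk.length_append, SimpleGraph.Walk.length_reverse,
      SimpleGraph.Walk.length_copy, SimpleGraph.Walk.length_copy, hl₁, hl₂, two_mul]
  · rw [SimpleGraph.Walk.mem_support_append_iff, SimpleGraph.Walk.support_reverse,
      List.mem_reverse, SimpleGraph.Walk.support_copy,
      SimpleGraph.Walk.support_copy] at hx
    rcases hx with hx | hx
    · obtain ⟨m, hm, rfl⟩ := hs₁ x hx
      exact ⟨hm, Or.inl rfl⟩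
    · obtain ⟨m, hm, rfl⟩ := hs₂ x hx
      exact ⟨hm, Or.inr rfl⟩

/-! ### The lower bounds -/

/-- For `d ≥ k * 2 ^ (k + 2)` some planar graph has `d`-admissibility at least `2 ^ k - 1`. -/
theorem exists_planar_two_pow_sub_one_le_adm {k d : ℕ} (hd : k * 2 ^ (k + 2) ≤ d) :
    ∃ (V : Type) (_ : Fintype V) (G : SimpleGraph V),
      IsPlanarGraph G ∧ 2 ^ k - 1 ≤ adm G d := by
  have hturn : ∀ j i : Fin (2 ^ k), j ≠ i → ∃ g l, g < k ∧ TurnsAt (2 ^ k) j i g l :=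
    fun j i h => exists_turnsAt j.2 i.2 (Fin.val_injective.ne h)
  -- The sets of `routeSet` need total `g` and `l`; their values on the diagonal never matter.
  choose! g l hg ht using hturn
  have : NeZero (2 ^ k) := ⟨by positivity⟩
  have hpl := isPlanarGraph_levelGraph (E := TreeEdge (2 * 2 ^ k - 1))
    fun y a a' b b' h h' hab => h.le_of_lt h' hab
  have := hpl.exists_finite_card_sub_one_le_adm (ι := Fin (2 ^ k)) (d := d)
    (fun j => (0, (j : ℕ))) (fun a b h => Fin.ext (Prod.ext_iff.1 h).2)
    (fun j i => routeSet (2 ^ k) (g j i * (2 * 2 ^ k - 1 + 1) + l j i + 1) j i)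
    (fun j i hji => ?_)
    (fun j i i' hji hji' hii x hx hx' => (ht j i hji).routeSet_inter (ht j i' hji') j.2 i.2 i'.2
      (Fin.val_injective.ne hii) hx hx')
  · rwa [Fintype.card_fin] at this
  · obtain ⟨w, hw, hs⟩ := (ht j i hji).exists_walk i.2
    refine ⟨w, hw.trans_le (le_trans ?_ hd), hs⟩
    have h1 := (ht j i hji).offset_le
    have h2 := Nat.mul_le_mul_right (2 * 2 ^ k - 1 + 1) (hg j i hji)
    have h3 : 0 < 2 ^ k := by positivity
    have h4 : k * 2 ^ (k + 2) = 2 * (k * (2 * 2 ^ k - 1 + 1)) := by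
      rw [Nat.sub_add_cancel (by omega)]; ring
    rw [Nat.succ_mul] at h2
    omega

theorem exists_planar_one_le_adm {d : ℕ} (hd : 1 ≤ d) :
    ∃ (V : Type) (_ : Fintype V) (G : SimpleGraph V), IsPlanarGraph G ∧ 1 ≤ adm G d := by
  have hpl := isPlanarGraph_levelGraph (E := fun _ a b => a = 0 ∧ b = 0) (by omega)
  refine hpl.exists_finite_card_sub_one_le_adm (ι := Bool) (d := d)
    (fun b => (b.toNat, 0)) (by decide) (fun _ _ => Set.univ) ?_ ?_
  · intro j i hji
    have hadj : (levelGraph fun _ a b => a = 0 ∧ b = 0).Adj (j.toNat, 0) (i.toNat, 0) := by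
      cases j <;> cases i <;> simp_all [levelGraph]
    exact ⟨hadj.toWalk, by simpa using hd, by simp⟩
  · intro j i i'
    cases j <;> cases i <;> cases i' <;> simp

theorem propositionA1 :
    (∀ k : ℕ, 2 ≤ k →
      ∃ (V : Type) (_ : Fintype V) (G : SimpleGraph V),
        IsPlanarGraph G ∧ 2 ^ k - 1 ≤ adm G (k * 2 ^ (k + 2))) ∧
    (∃ c : ℝ, 0 < c ∧ ∀ d : ℕ, 2 ≤ d →
      ∃ (V : Type) (_ : Fintype V) (G : SimpleGraph V),
        IsPlanarGraph G ∧ c * ((d : ℝ) / Real.log d) ≤ (adm G d : ℝ)) := by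
  refine ⟨fun k _ => exists_planar_two_pow_sub_one_le_adm le_rfl, 1 / 64, by norm_num,
    fun d hd => ?_⟩
  have hlog2 : (1 : ℝ) / 2 ≤ Real.log 2 := by linarith [Real.log_two_gt_d9]
  have hd' : (2 : ℝ) ≤ d := by exact_mod_cast hd
  have hlogd : Real.log 2 ≤ Real.log d := Real.log_le_log (by norm_num) hd'
  rcases lt_or_ge d 32 with hlt | hge
  · obtain ⟨V, hV, G, hG, h⟩ := exists_planar_one_le_adm (d := d) (by omega)
    refine ⟨V, hV, G, hG, le_trans ?_ (show (1 : ℝ) ≤ _ by exact_mod_cast h)⟩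
    have h1 : (d : ℝ) < 32 := by exact_mod_cast hlt
    have h2 : (d : ℝ) / Real.log d ≤ 64 := by
      rw [div_le_iff₀ (by linarith)]
      linarith
    linarith
  -- The least such `m` is the largest k with k * 2^(k+2) ≤ d; the threshold 32 = 2 * 2^4 ensures k
  -- ≥ 2.
  · have hex : ∃ m, d < (m + 1) * 2 ^ (m + 3) := by
      refine ⟨d, Nat.lt_two_pow_self.trans_le ?_⟩
      calc 2 ^ d ≤ 2 ^ (d + 3) := Nat.pow_le_pow_right two_pos (by omega)
        _ ≤ _ := Nat.le_mul_of_pos_left _ d.succ_pos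
    obtain ⟨k, hk⟩ : ∃ k, Nat.find hex = k := ⟨_, rfl⟩
    have hupper : d < (k + 1) * 2 ^ (k + 3) := hk ▸ Nat.find_spec hex
    have hk2 : 2 ≤ k := by
      by_contra hc
      have : k = 0 ∨ k = 1 := by omega
      rcases this with rfl | rfl <;> norm_num at hupper <;> omega
    have hlower : k * 2 ^ (k + 2) ≤ d := by
      have := Nat.find_min hex (m := k - 1) (by omega)
      rw [show k - 1 + 1 = k by omega, show k - 1 + 3 = k + 2 by omega] at this
      omega
    obtain ⟨V, hV, G, hG, h⟩ := exists_planar_two_pow_sub_one_le_adm hlower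
    refine ⟨V, hV, G, hG, le_trans ?_ (Nat.cast_le.2 h)⟩
    have hpow : (4 : ℝ) ≤ 2 ^ k := by
      calc (4 : ℝ) = 2 ^ 2 := by norm_num
        _ ≤ 2 ^ k := pow_le_pow_right₀ (by norm_num) hk2
    rw [Nat.cast_sub Nat.one_le_two_pow]
    push_cast
    have hkR : (2 : ℝ) ≤ k := by exact_mod_cast hk2
    have hup : (d : ℝ) ≤ (k + 1) * (8 * 2 ^ k) := by
      have : (d : ℝ) ≤ (k + 1) * 2 ^ (k + 3) := by exact_mod_cast hupper.le
      rw [pow_add] at this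
      linarith
    have hlow : (2 : ℝ) ^ k ≤ d := by
      have h1 : 2 ^ k ≤ k * 2 ^ (k + 2) := calc
        2 ^ k ≤ 2 ^ (k + 2) := Nat.pow_le_pow_right two_pos (by omega)
        _ ≤ _ := Nat.le_mul_of_pos_left _ (by omega)
      exact_mod_cast h1.trans hlower
    have hlogk : (k : ℝ) / 2 ≤ Real.log d := by
      have := Real.log_le_log (by positivity) hlow
      rw [Real.log_pow] at this
      nlinarith
    -- The quotient is at most 16 * 2^k * (k+1)/k. With the factor 1/64 the bound 32 * 2^k becomes
    -- 2^k / 2 ≤ 2^k - 1.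
    have h2 : (d : ℝ) / Real.log d ≤ 32 * 2 ^ k := by
      rw [div_le_iff₀ (by linarith)]
      nlinarith [mul_le_mul_of_nonneg_left hlogk (show (0 : ℝ) ≤ 32 * 2 ^ k by positivity),
        mul_le_mul_of_nonneg_right hkR (show (0 : ℝ) ≤ 2 ^ k by positivity)]
    linarith
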